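/- Let $n=2$ or $n=3$ and let $G\subset O(n)$ be a closed subgroup which is non-transitive, i.e. which does not act transitively on the Euclidean unit sphere of $\mathbb{R}^n$. Then there is a $G$-invariant polyellipse/polyellipsoid that is a non-Euclidean unit body with smooth boundary. That is, there are a nonempty finite $G$-invariant set $W\subset\mathbb{R}^n$ (the focuses) and a real number $c$ such that $$K=\Bigl\{v\in\mathbb{R}^n \ \Big|\ \sum_{w\in W}\|v-w\|\le c\Bigr\}$$ contains all the points of $W$ in its interior, is a compact convex body containing the origin in its interior, and satisfies (K1) $K$ is not the closed unit ball of any inner product on $\mathbb{R}^n$; (K2) $K$ is invariant under the elements of $G$, i.e. $g(K)=K$ for all $g\in G$; (K3) the boundary $\partial K$ is a smooth ($C^\infty$) hypersurface of $\mathbb{R}^n$. -/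

import Mathlib

open Set
open scoped ContDiff

/-- The action of an orthogonal matrix on a vector of Euclidean space, `v ↦ g v`. -/
noncomputable def orthAct {n : ℕ} (g : Matrix.orthogonalGroup (Fin n) ℝ)
    (v : EuclideanSpace ℝ (Fin n)) : EuclideanSpace ℝ (Fin n) :=
  WithLp.toLp 2 (Matrix.mulVec (g : Matrix (Fin n) (Fin n) ℝ) (WithLp.ofLp v))

/-- `G` is transitive (on the Euclidean unit sphere centered at the origin): any unit vector is
carried to any other unit vector by some element of `G`. -/
def IsTransitiveOnSphere {n : ℕ} (G : Subgroup (Matrix.orthogonalGroup (Fin n) ℝ)) : Prop :=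
  ∀ v ∈ Metric.sphere (0 : EuclideanSpace ℝ (Fin n)) 1,
    ∀ w ∈ Metric.sphere (0 : EuclideanSpace ℝ (Fin n)) 1, ∃ g ∈ G, orthAct g v = w

/-- A set is invariant under `G` if every element of `G` maps it onto itself. -/
def IsInvariantUnder {n : ℕ} (G : Subgroup (Matrix.orthogonalGroup (Fin n) ℝ))
    (S : Set (EuclideanSpace ℝ (Fin n))) : Prop :=
  ∀ g ∈ G, orthAct g '' S = S

/-- The sublevel set `{v | ∑ d(v, w) ≤ c}`, the sum being taken over the points `w` of the finite
set `W` (counting measure on `W`). -/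
def sumDistSublevel {n : ℕ} (W : Finset (EuclideanSpace ℝ (Fin n))) (c : ℝ) :
    Set (EuclideanSpace ℝ (Fin n)) :=
  {v | ∑ w ∈ W, dist v w ≤ c}

/-- `K` is a polyellipse / polyellipsoid with the finite nonempty set `W` of focuses: it is a
sublevel set of the sum of the distances from the focuses, with a level large enough for `K` to
contain all the focuses in its interior. -/
def IsPolyellipsoid {n : ℕ} (W : Finset (EuclideanSpace ℝ (Fin n)))
    (K : Set (EuclideanSpace ℝ (Fin n))) : Prop :=
  W.Nonempty ∧ (∃ c : ℝ, K = sumDistSublevel W c) ∧ ∀ w ∈ W, w ∈ interior K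

/-- `K` is the closed unit ball with respect to some inner product on `ℝⁿ` (not necessarily the
canonical one). -/
def IsInnerProductUnitBall {n : ℕ} (K : Set (EuclideanSpace ℝ (Fin n))) : Prop :=
  ∃ B : InnerProductSpace.Core ℝ (EuclideanSpace ℝ (Fin n)), K = {x | B.inner x x ≤ 1}

/-- `S` is a smooth (that is, `C^∞`, embedded) hypersurface: around each of its points it is the
zero set of a smooth real-valued function with nonvanishing differential. -/
def IsSmoothHypersurface {n : ℕ} (S : Set (EuclideanSpace ℝ (Fin n))) : Prop :=
  ∀ p ∈ S, ∃ U : Set (EuclideanSpace ℝ (Fin n)), IsOpen U ∧ p ∈ U ∧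
    ∃ φ : EuclideanSpace ℝ (Fin n) → ℝ, ContDiffOn ℝ ∞ φ U ∧
      (∀ x ∈ U, fderiv ℝ φ x ≠ 0) ∧ S ∩ U = {x ∈ U | φ x = 0}

/-! A non-transitive closed `G` in dimension 2 or 3 has a nonzero vector `v` with finite orbit. The
focuses are that orbit, its negative and `0`; let `F` be the sum of distances to them. `F` is
convex, even and `G`-invariant, it is largest among the focuses at `v`, and `F 0 < F v`. For a level
`c > F v` the set `F = c` avoids the focuses, so `F` is smooth there, and convexity rules out
critical points.

The sublevel set is no ellipsoid once `c` is close to `F v`: along some line through `v`, `F` has a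
kink and grows linearly both ways, while the parallelogram law allows a quadratic form only a
second-order increase (`exists_level_not_ellipsoid`).

For the finite orbit, let `G` be infinite. By compactness its tangent cone at `1` contains a nonzero
skew matrix. For `n = 2` this already forces transitivity. For `n = 3` the axes of the tangent
matrices span a nonzero invariant subspace `V`; `V = ⊤` forces transitivity, so `V` or `Vᗮ` is an
invariant line, and a vector on it has at most two images. Transitivity comes from maximizing the
height over a target point along a compact orbit. -/

/-! ### Convexity, smoothness and kinks of sums of distances. -/

section SumDist

variable {E : Type*} [NormedAddCommGroup E]

/-- The sum of the distances from the points of a finite set. -/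
noncomputable def sumDist (W : Finset E) (x : E) : ℝ := ∑ w ∈ W, dist x w

theorem sumDist_sub_le (W : Finset E) (x y : E) :
    sumDist W x - sumDist W y ≤ W.card * dist x y := by
  unfold sumDist
  rw [← Finset.sum_sub_distrib, ← nsmul_eq_mul]
  refine Finset.sum_le_card_nsmul _ _ _ fun w _ => ?_
  linarith [dist_triangle x y w]

theorem continuous_sumDist (W : Finset E) : Continuous (sumDist W) := by
  unfold sumDist
  fun_prop

theorem sumDist_neg {W : Finset E} (hW : ∀ w ∈ W, -w ∈ W) (x : E) :
    sumDist W (-x) = sumDist W x := by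
  unfold sumDist
  refine Finset.sum_nbij' (fun w => -w) (fun w => -w) hW hW (by simp) (by simp) fun w _ => ?_
  rw [← dist_neg_neg, neg_neg]

theorem mem_interior_of_sumDist_lt {W : Finset E} {c : ℝ} {x : E} (hx : sumDist W x < c) :
    x ∈ interior {x | sumDist W x ≤ c} :=
  interior_maximal (fun _ h => le_of_lt h)
    (isOpen_lt (continuous_sumDist W) continuous_const) hx

variable [InnerProductSpace ℝ E]

theorem convexOn_sumDist (W : Finset E) : ConvexOn ℝ univ (sumDist W) := by
  classical
  unfold sumDist
  induction W using Finset.induction_on with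
  | empty => simpa using convexOn_const (0 : ℝ) convex_univ
  | insert a s ha ih =>
    simp only [Finset.sum_insert ha]
    exact (convexOn_dist a convex_univ).add ih

theorem isCompact_sumDist_le [FiniteDimensional ℝ E] {W : Finset E} (hW : W.Nonempty) (c : ℝ) :
    IsCompact {x | sumDist W x ≤ c} := by
  obtain ⟨w, hw⟩ := hW
  have := FiniteDimensional.proper_real E
  refine (isCompact_closedBall w c).of_isClosed_subset
    (isClosed_le (continuous_sumDist W) continuous_const) fun x hx => ?_
  exact (Finset.single_le_sum (f := fun w => dist x w) (fun _ _ => dist_nonneg) hw).trans hx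

theorem sumDist_contDiffAt {W : Finset E} {x : E} (hx : x ∉ W) :
    ContDiffAt ℝ ∞ (sumDist W) x := by
  unfold sumDist
  refine ContDiffAt.sum fun w hw => ?_
  exact contDiffAt_id.dist ℝ contDiffAt_const fun h => hx (by simpa [← h] using hw)

/-- Restricted to the segment from `x` to `y` the function is convex; a zero slope at `x` would keep
it from decreasing towards `y`. -/
theorem fderiv_sumDist_ne_zero {W : Finset E} {x y : E} (hx : x ∉ W)
    (hy : sumDist W y < sumDist W x) : fderiv ℝ (sumDist W) x ≠ 0 := by
  intro h0
  have hd : HasFDerivAt (sumDist W) (0 : E →L[ℝ] ℝ) x := by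
    rw [← h0]
    exact ((sumDist_contDiffAt hx).differentiableAt (by simp)).hasFDerivAt
  have hl : HasDerivAt (AffineMap.lineMap x y : ℝ → E) (y - x) 0 := by
    exact AffineMap.hasDerivAt_lineMap
  have hd' : HasDerivAt (sumDist W ∘ (AffineMap.lineMap x y : ℝ → E)) 0 0 := by
    have := HasFDerivAt.comp_hasDerivAt (0 : ℝ) (l := sumDist W) (l' := (0 : E →L[ℝ] ℝ))
      (by simpa using hd) hl
    simpa using this
  have hc : ConvexOn ℝ univ (sumDist W ∘ (AffineMap.lineMap x y : ℝ → E)) := by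
    simpa using (convexOn_sumDist W).comp_affineMap (AffineMap.lineMap x y)
  have := hc.le_slope_of_hasDerivAt (mem_univ 0) (mem_univ 1) one_pos hd'
  simp [slope_def_field] at this
  linarith

theorem frontier_sumDist_le {W : Finset E} {c : ℝ} {y : E} (hW : ∀ w ∈ W, sumDist W w < c)
    (hy : sumDist W y < c) :
    frontier {x | sumDist W x ≤ c} = {x | sumDist W x = c} := by
  refine (frontier_le_subset_eq (continuous_sumDist W) continuous_const).antisymm fun x hx => ?_
  have hx' : sumDist W x = c := hx
  refine ⟨subset_closure hx'.le, fun hi => ?_⟩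
  refine fderiv_sumDist_ne_zero (W := W) (x := x) (y := y)
    (fun hw => (hW x hw).ne hx') (by rwa [hx']) ?_
  -- An interior point at level `c` would be a local maximum, hence critical.
  refine IsLocalMax.fderiv_eq_zero ?_
  filter_upwards [mem_interior_iff_mem_nhds.1 hi] with z hz
  rw [hx']; exact hz

/-- The sum of the distances has a kink at a focus: in a suitable direction it increases on both
sides at least with unit speed. -/
theorem exists_unit_sumDist_add_le [FiniteDimensional ℝ E] (hE : 2 ≤ Module.finrank ℝ E)
    {W : Finset E} {v : E} (hv : v ∈ W) :
    ∃ u : E, ‖u‖ = 1 ∧ ∀ s : ℝ, sumDist W v + |s| ≤ sumDist W (v + s • u) := by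
  classical
  -- `g` is the gradient at `v` of the terms other than the focus `v`. A direction orthogonal to `g`
  -- leaves those terms stationary, so by convexity they cannot drop; the term of `v` contributes
  -- `|s|`.
  set g : E := ∑ w ∈ W.erase v, (‖v - w‖⁻¹ : ℝ) • (v - w) with hg
  obtain ⟨u₀, hu₀, hne⟩ : ∃ u ∈ (ℝ ∙ g)ᗮ, u ≠ 0 := by
    apply Submodule.exists_mem_ne_zero_of_ne_bot
    intro hb
    have h1 := Submodule.finrank_add_finrank_orthogonal (ℝ ∙ g)
    have h2 := finrank_span_le_card (R := ℝ) ({g} : Set E)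
    simp only [toFinset_singleton, Finset.card_singleton] at h2
    rw [hb, finrank_bot] at h1
    omega
  set u : E := ‖u₀‖⁻¹ • u₀ with hu
  have hu1 : ‖u‖ = 1 := by
    rw [hu, norm_smul, norm_inv, norm_norm, inv_mul_cancel₀ (norm_ne_zero_iff.2 hne)]
  have hgu : inner ℝ g u = 0 := by
    rw [hu, inner_smul_right, Submodule.mem_orthogonal_singleton_iff_inner_right.1 hu₀, mul_zero]
  refine ⟨u, hu1, fun s => ?_⟩
  unfold sumDist
  rw [← Finset.add_sum_erase _ _ hv, ← Finset.add_sum_erase _ _ hv]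
  have key : ∀ w ∈ W.erase v,
      dist v w + s * inner ℝ ((‖v - w‖⁻¹ : ℝ) • (v - w)) u ≤ dist (v + s • u) w := by
    intro w hw
    have hne : 0 < ‖v - w‖ := norm_pos_iff.2 (sub_ne_zero.2 (Finset.ne_of_mem_erase hw).symm)
    have h1 := real_inner_le_norm (v - w) (v + s • u - w)
    have h2 : v + s • u - w = (v - w) + s • u := by abel
    rw [h2, inner_add_right, real_inner_self_eq_norm_sq, inner_smul_right] at h1
    rw [dist_eq_norm, dist_eq_norm, h2, real_inner_smul_left]
    refine le_of_mul_le_mul_left ?_ hne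
    refine le_trans (le_of_eq ?_) h1
    field_simp
  have hsum := Finset.sum_le_sum key
  rw [Finset.sum_add_distrib, ← Finset.mul_sum, ← sum_inner, ← hg, hgu] at hsum
  have : dist (v + s • u) v = |s| := by simp [norm_smul, hu1]
  rw [this, dist_self]
  linarith

theorem core_parallelogram (B : InnerProductSpace.Core ℝ E) (x y : E) :
    B.inner (x + y) (x + y) + B.inner (x - y) (x - y) = 2 * B.inner x x + 2 * B.inner y y := by
  have hr : ∀ x y z, B.inner x (y + z) = B.inner x y + B.inner x z := by
    intro x y z
    have h := fun a b => B.conj_inner_symm a b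
    simp only [conj_trivial] at h
    rw [← h x (y + z), B.add_left, h x y, h x z]
  have hn : ∀ x y, B.inner (-x) y = - B.inner x y := by
    intro x y
    simpa using B.smul_left x y (-1)
  have hn' : ∀ x y, B.inner x (-y) = - B.inner x y := by
    intro x y
    have h := fun a b => B.conj_inner_symm a b
    simp only [conj_trivial] at h
    rw [← h x (-y), hn, h x y]
  simp only [sub_eq_add_neg, B.add_left, hr, hn, hn']
  ring

theorem core_smul (B : InnerProductSpace.Core ℝ E) (s : ℝ) (x : E) :
    B.inner (s • x) (s • x) = s ^ 2 * B.inner x x := by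
  have h := fun a b => B.conj_inner_symm a b
  have h1 := fun a b => B.smul_left a b s
  simp only [conj_trivial] at h h1
  rw [h1, ← h x (s • x), h1]
  ring

/-- For a level close to the value at a focus of maximal value, the sublevel set is not an
ellipsoid. -/
theorem exists_level_not_ellipsoid [FiniteDimensional ℝ E] (hE : 2 ≤ Module.finrank ℝ E)
    {W : Finset E} {v : E} (hv : v ∈ W) (h0 : sumDist W 0 < sumDist W v) :
    ∃ c, sumDist W v < c ∧
      ∀ B : InnerProductSpace.Core ℝ E, {x | sumDist W x ≤ c} ≠ {x | B.inner x x ≤ 1} := by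
  obtain ⟨u, hu, hkink⟩ := exists_unit_sumDist_add_le hE hv
  have hN : (0 : ℝ) < W.card := by exact_mod_cast Finset.card_pos.2 ⟨v, hv⟩
  set N : ℝ := (W.card : ℝ)
  -- `sumDist W` is `N`-Lipschitz, so the ball of radius `r` about `0` lies in the sublevel set;
  -- this bounds `B.inner u u` by `1 / r ^ 2`.
  set r : ℝ := (sumDist W v - sumDist W 0) / N with hr
  have hr0 : 0 < r := div_pos (by linarith) hN
  set D : ℝ := 2 * N * (‖v‖ + 1) / r ^ 2 with hD
  have hD0 : 0 < D := by positivity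
  -- `D` is chosen so that `D * t ≤ 1` gives `N * (m * (‖v‖ + 1)) ≤ t / 2` below, where `m = t ^ 2 /
  -- r ^ 2` bounds the form at `t • u`.
  set t : ℝ := min 1 D⁻¹ with ht
  have ht0 : 0 < t := by positivity
  have ht1 : t ≤ 1 := min_le_left _ _
  have htD : D * t ≤ 1 := by
    calc D * t ≤ D * D⁻¹ := by gcongr; exact min_le_right _ _
      _ = 1 := mul_inv_cancel₀ hD0.ne'
  refine ⟨sumDist W v + t / 4, by linarith, fun B hB => ?_⟩
  have hmem : ∀ x, sumDist W x ≤ sumDist W v + t / 4 ↔ B.inner x x ≤ 1 := fun x =>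
    Set.ext_iff.1 hB x
  have hqu : B.inner u u ≤ 1 / r ^ 2 := by
    have h1 := sumDist_sub_le W (r • u) 0
    rw [dist_zero_right, norm_smul, hu, mul_one, Real.norm_of_nonneg hr0.le, hr,
      mul_div_cancel₀ _ hN.ne'] at h1
    have h2 := (hmem (r • u)).1 (by linarith)
    rw [core_smul] at h2
    rw [le_div_iff₀ (by positivity)]
    linarith
  have hqv : B.inner v v ≤ 1 := (hmem v).1 (by linarith)
  set m : ℝ := t ^ 2 / r ^ 2 with hm
  have hm0 : 0 < m := by positivity
  have hNm : N * (m * (‖v‖ + 1)) ≤ t / 2 := by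
    have : N * (m * (‖v‖ + 1)) = (D * t) * t / 2 := by
      rw [hm, hD]; field_simp
    rw [this]
    nlinarith
  -- Otherwise shrinking `z` by `1 + m` lands in the body, so the sum at `z` exceeds that at `v` by
  -- at most `t / 4 + t / 2`, whereas the kink makes it exceed by at least `t`.
  have key : ∀ s : ℝ, |s| = t → 1 + m < B.inner (v + s • u) (v + s • u) := by
    intro s hs
    by_contra! hle
    set z := v + s • u with hz
    have hzn : ‖z‖ ≤ ‖v‖ + 1 := by
      refine (norm_add_le _ _).trans ?_
      rw [norm_smul, hu, Real.norm_eq_abs, hs]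
      linarith
    have hy : B.inner ((1 + m)⁻¹ • z) ((1 + m)⁻¹ • z) ≤ 1 := by
      rw [core_smul, inv_pow, inv_mul_le_iff₀ (by positivity)]
      nlinarith
    have h1 := (hmem _).2 hy
    have h2 := sumDist_sub_le W z ((1 + m)⁻¹ • z)
    have h3 : dist z ((1 + m)⁻¹ • z) ≤ m * (‖v‖ + 1) := by
      have : z - (1 + m)⁻¹ • z = (m * (1 + m)⁻¹) • z := by
        nth_rewrite 1 [← one_smul ℝ z]
        rw [← sub_smul]
        congr 1
        field_simp
        ring
      rw [dist_eq_norm, this, norm_smul, Real.norm_of_nonneg (by positivity)]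
      have : (1 + m)⁻¹ ≤ 1 := inv_le_one_of_one_le₀ (by linarith)
      refine mul_le_mul (mul_le_of_le_one_right hm0.le this) hzn (norm_nonneg _) hm0.le
    have h4 := hkink s
    rw [hs] at h4
    have h5 := mul_le_mul_of_nonneg_left h3 hN.le
    linarith
  -- The two values at `v ± t • u` add up to at most `2 + 2 * m`, yet each exceeds `1 + m`.
  have hp := core_parallelogram B v (t • u)
  have k1 := key t (abs_of_pos ht0)
  have k2 := key (-t) (by rw [abs_neg, abs_of_pos ht0])
  rw [neg_smul, ← sub_eq_add_neg] at k2
  rw [core_smul] at hp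
  have : t ^ 2 * B.inner u u ≤ m := by
    rw [hm, div_eq_mul_one_div]
    gcongr
  linarith

/-- Average over `v` and `-v`: `‖w - v‖ + ‖w + v‖ ≥ 2‖w‖`, strictly for the focus `w = 0`. -/
theorem sumDist_zero_lt {W : Finset E} (hW : ∀ w ∈ W, -w ∈ W) (h0 : (0 : E) ∈ W) {v : E}
    (hv : v ≠ 0) : sumDist W 0 < sumDist W v := by
  have h1 : sumDist W 0 + sumDist W 0 < sumDist W v + sumDist W (-v) := by
    unfold sumDist
    rw [← Finset.sum_add_distrib, ← Finset.sum_add_distrib]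
    refine Finset.sum_lt_sum (fun w _ => ?_) ⟨0, h0, ?_⟩
    · have h := dist_triangle v 0 w
      have e1 : dist v w = ‖w - v‖ := by rw [dist_comm, dist_eq_norm]
      have e2 : dist (-v) w = ‖w + v‖ := by rw [dist_comm, dist_eq_norm, sub_neg_eq_add]
      have e3 : w + w = (w - v) + (w + v) := by abel
      have e4 : ‖w + w‖ = ‖w‖ + ‖w‖ := by rw [← two_smul ℝ w, norm_smul]; norm_num; ring
      rw [dist_zero_left, e1, e2, ← e4, e3]
      exact norm_add_le _ _
    · simpa using hv
  rw [sumDist_neg hW] at h1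
  linarith

end SumDist

/-! ### The orthogonal action, and the polyellipsoid of a finite orbit. -/

section Action

variable {n : ℕ}

theorem orthAct_add (g : Matrix.orthogonalGroup (Fin n) ℝ) (x y : EuclideanSpace ℝ (Fin n)) :
    orthAct g (x + y) = orthAct g x + orthAct g y := by
  simp [orthAct, Matrix.mulVec_add]

theorem orthAct_smul (g : Matrix.orthogonalGroup (Fin n) ℝ) (s : ℝ)
    (x : EuclideanSpace ℝ (Fin n)) : orthAct g (s • x) = s • orthAct g x := by
  simp [orthAct, Matrix.mulVec_smul]

theorem orthAct_neg (g : Matrix.orthogonalGroup (Fin n) ℝ)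
    (x : EuclideanSpace ℝ (Fin n)) : orthAct g (-x) = -orthAct g x := by
  simp [orthAct, Matrix.mulVec_neg]

theorem orthAct_mul (g h : Matrix.orthogonalGroup (Fin n) ℝ) (x : EuclideanSpace ℝ (Fin n)) :
    orthAct (g * h) x = orthAct g (orthAct h x) := by
  simp [orthAct, Matrix.mulVec_mulVec]

theorem orthAct_one (x : EuclideanSpace ℝ (Fin n)) :
    orthAct 1 x = x := by
  simp [orthAct]

theorem orthAct_inv_orthAct (g : Matrix.orthogonalGroup (Fin n) ℝ)
    (x : EuclideanSpace ℝ (Fin n)) : orthAct g⁻¹ (orthAct g x) = x := by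
  rw [← orthAct_mul, inv_mul_cancel, orthAct_one]

theorem orthAct_orthAct_inv (g : Matrix.orthogonalGroup (Fin n) ℝ)
    (x : EuclideanSpace ℝ (Fin n)) : orthAct g (orthAct g⁻¹ x) = x := by
  rw [← orthAct_mul, mul_inv_cancel, orthAct_one]

theorem inner_orthAct (g : Matrix.orthogonalGroup (Fin n) ℝ) (x y : EuclideanSpace ℝ (Fin n)) :
    inner ℝ (orthAct g x) (orthAct g y) = inner ℝ x y := by
  have hg : (g : Matrix (Fin n) (Fin n) ℝ).transpose * (g : Matrix (Fin n) (Fin n) ℝ) = 1 :=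
    (Matrix.mem_orthogonalGroup_iff' (Fin n) ℝ).1 g.2
  simp only [orthAct, EuclideanSpace.inner_eq_star_dotProduct, star_trivial]
  rw [Matrix.dotProduct_mulVec, ← Matrix.mulVec_transpose, Matrix.mulVec_mulVec, hg,
    Matrix.one_mulVec]

theorem norm_orthAct (g : Matrix.orthogonalGroup (Fin n) ℝ) (x : EuclideanSpace ℝ (Fin n)) :
    ‖orthAct g x‖ = ‖x‖ := by
  rw [norm_eq_sqrt_real_inner, norm_eq_sqrt_real_inner x, inner_orthAct]

theorem dist_orthAct (g : Matrix.orthogonalGroup (Fin n) ℝ) (x y : EuclideanSpace ℝ (Fin n)) :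
    dist (orthAct g x) (orthAct g y) = dist x y := by
  rw [dist_eq_norm, dist_eq_norm, sub_eq_add_neg, ← orthAct_neg, ← orthAct_add, norm_orthAct,
    sub_eq_add_neg]

theorem isInvariantUnder_of_mapsTo {G : Subgroup (Matrix.orthogonalGroup (Fin n) ℝ)}
    {S : Set (EuclideanSpace ℝ (Fin n))} (h : ∀ g ∈ G, ∀ x ∈ S, orthAct g x ∈ S) :
    IsInvariantUnder G S := fun g hg =>
  (image_subset_iff.2 (h g hg)).antisymm fun x hx =>
    ⟨orthAct g⁻¹ x, h _ (G.inv_mem hg) x hx, orthAct_orthAct_inv g x⟩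

theorem sumDist_orthAct {G : Subgroup (Matrix.orthogonalGroup (Fin n) ℝ)}
    {W : Finset (EuclideanSpace ℝ (Fin n))} (hW : ∀ g ∈ G, ∀ x ∈ W, orthAct g x ∈ W)
    {g : Matrix.orthogonalGroup (Fin n) ℝ} (hg : g ∈ G) (x : EuclideanSpace ℝ (Fin n)) :
    sumDist W (orthAct g x) = sumDist W x := by
  unfold sumDist
  symm
  refine Finset.sum_nbij' (orthAct g) (orthAct g⁻¹) (hW g hg) (hW _ (G.inv_mem hg))
    (fun _ _ => orthAct_inv_orthAct g _) (fun _ _ => orthAct_orthAct_inv g _) fun w _ => ?_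
  rw [dist_orthAct]

theorem exists_polyellipsoid_of_finite_orbit (hn : 2 ≤ n)
    (G : Subgroup (Matrix.orthogonalGroup (Fin n) ℝ)) {v : EuclideanSpace ℝ (Fin n)}
    (hv : v ≠ 0) (hfin : {x | ∃ g ∈ G, orthAct g v = x}.Finite) :
    ∃ (W : Finset (EuclideanSpace ℝ (Fin n))) (K : Set (EuclideanSpace ℝ (Fin n))),
      IsPolyellipsoid W K ∧ IsInvariantUnder G (W : Set (EuclideanSpace ℝ (Fin n))) ∧
      IsCompact K ∧ Convex ℝ K ∧ (0 : EuclideanSpace ℝ (Fin n)) ∈ interior K ∧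
      ¬ IsInnerProductUnitBall K ∧ IsInvariantUnder G K ∧
      IsSmoothHypersurface (frontier K) := by
  classical
  obtain ⟨W, hW⟩ : ∃ W : Finset (EuclideanSpace ℝ (Fin n)), ∀ x, x ∈ W ↔
      x = 0 ∨ (∃ g ∈ G, orthAct g v = x) ∨ ∃ g ∈ G, orthAct g v = -x := by
    refine ⟨insert 0 (hfin.toFinset ∪ hfin.toFinset.image Neg.neg), fun x => ?_⟩
    simp only [Finset.mem_insert, Finset.mem_union, Set.Finite.mem_toFinset, Finset.mem_image,
      Set.mem_ofPred_eq]
    refine or_congr_right (or_congr_right ⟨?_, ?_⟩)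
    · rintro ⟨a, ⟨g, hg, h⟩, rfl⟩
      exact ⟨g, hg, by rw [h, neg_neg]⟩
    · rintro ⟨g, hg, h⟩
      exact ⟨-x, ⟨g, hg, h⟩, neg_neg x⟩
  have h0W : (0 : EuclideanSpace ℝ (Fin n)) ∈ W := (hW 0).2 (Or.inl rfl)
  have hvW : v ∈ W := (hW v).2 (Or.inr (Or.inl ⟨1, G.one_mem, orthAct_one v⟩))
  have hneg : ∀ w ∈ W, -w ∈ W := by
    intro w hw
    rw [hW] at hw ⊢
    rw [neg_neg, neg_eq_zero]
    exact hw.imp_right Or.symm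
  have hGW : ∀ g ∈ G, ∀ x ∈ W, orthAct g x ∈ W := by
    intro g hg x hx
    rw [hW] at hx ⊢
    rcases hx with rfl | ⟨h, hh, rfl⟩ | ⟨h, hh, hx⟩
    · left; simp [orthAct]
    · exact Or.inr (Or.inl ⟨g * h, G.mul_mem hg hh, orthAct_mul _ _ _⟩)
    · exact Or.inr (Or.inr ⟨g * h, G.mul_mem hg hh, by rw [orthAct_mul, hx, orthAct_neg]⟩)
  have hlt : sumDist W 0 < sumDist W v := sumDist_zero_lt hneg h0W hv
  -- All focuses but `0` lie on the orbit of `v` or its negative, where the sum has the same value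
  -- as at `v`.
  have hle : ∀ w ∈ W, sumDist W w ≤ sumDist W v := by
    intro w hw
    rcases (hW w).1 hw with rfl | ⟨g, hg, rfl⟩ | ⟨g, hg, h⟩
    · exact hlt.le
    · exact (sumDist_orthAct hGW hg v).le
    · rw [← sumDist_neg hneg w, ← h]
      exact (sumDist_orthAct hGW hg v).le
  obtain ⟨c, hc, hB⟩ := exists_level_not_ellipsoid (by simpa using hn) hvW hlt
  refine ⟨W, {x | sumDist W x ≤ c}, ⟨⟨v, hvW⟩, ⟨c, rfl⟩, fun w hw =>
    mem_interior_of_sumDist_lt ((hle w hw).trans_lt hc)⟩, isInvariantUnder_of_mapsTo hGW,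
    isCompact_sumDist_le ⟨v, hvW⟩ c, ?_, mem_interior_of_sumDist_lt (hlt.trans hc),
    fun ⟨B, h⟩ => hB B h, isInvariantUnder_of_mapsTo fun g hg x hx => ?_, ?_⟩
  · simpa using (convexOn_sumDist W).convex_le c
  · exact (sumDist_orthAct hGW hg x).le.trans hx
  · rw [frontier_sumDist_le (fun w hw => (hle w hw).trans_lt hc) (hlt.trans hc)]
    intro p hp
    have hnot : ∀ x ∈ {x | sumDist W v < sumDist W x}, x ∉ W := fun x hx hxW =>
      (hle x hxW).not_gt hx
    have hp' : sumDist W p = c := hp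
    -- This open set contains the boundary and no focus, so one defining function serves at every
    -- boundary point.
    refine ⟨{x | sumDist W v < sumDist W x},
      isOpen_lt continuous_const (continuous_sumDist W), hc.trans_eq hp'.symm,
      fun x => sumDist W x - c, fun x hx => ?_, fun x hx => ?_, ?_⟩
    · exact ((sumDist_contDiffAt (hnot x hx)).sub contDiffAt_const).contDiffWithinAt
    · rw [fderiv_sub_const]
      exact fderiv_sumDist_ne_zero (hnot x hx) (hlt.trans hx)
    · ext x
      simp only [mem_inter_iff, mem_ofPred_eq, sub_eq_zero]
      tauto

end Action

/-! ### The tangent cone of a closed group at the identity, and a criterion for transitivity. -/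

section TangentCone

open Filter Topology Matrix

variable {n : ℕ}

theorem compactSpace_orthogonalGroup : CompactSpace (Matrix.orthogonalGroup (Fin n) ℝ) := by
  refine isCompact_iff_compactSpace.1 (?_ :
    IsCompact (Matrix.orthogonalGroup (Fin n) ℝ : Set (Matrix (Fin n) (Fin n) ℝ)))
  have h : IsCompact (Set.univ.pi fun _ : Fin n => Set.univ.pi fun _ : Fin n => Set.Icc (-1 : ℝ) 1) :=
    isCompact_univ_pi fun _ => isCompact_univ_pi fun _ => isCompact_Icc
  refine IsCompact.of_isClosed_subset (X := Matrix (Fin n) (Fin n) ℝ) h isClosed_unitary ?_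
  intro U hU i _ j _
  exact abs_le.1 (entry_norm_bound_of_unitary hU i j)

/-- The tangent cone at the identity of a group of orthogonal matrices. -/
def tangentMatrices (G : Subgroup (Matrix.orthogonalGroup (Fin n) ℝ)) :
    Set (Matrix (Fin n) (Fin n) ℝ) :=
  tangentConeAt ℝ (Subtype.val '' (G : Set (Matrix.orthogonalGroup (Fin n) ℝ))) 1

theorem mem_tangentMatrices_iff {G : Subgroup (Matrix.orthogonalGroup (Fin n) ℝ)}
    {A : Matrix (Fin n) (Fin n) ℝ} :
    A ∈ tangentMatrices G ↔ ∃ (c : ℕ → ℝ) (g : ℕ → Matrix.orthogonalGroup (Fin n) ℝ),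
      (∀ k, g k ∈ G) ∧ Tendsto (fun k => (g k : Matrix (Fin n) (Fin n) ℝ) - 1) atTop (𝓝 0) ∧
      Tendsto (fun k => c k • ((g k : Matrix (Fin n) (Fin n) ℝ) - 1)) atTop (𝓝 A) := by
  have : FirstCountableTopology (Matrix (Fin n) (Fin n) ℝ) :=
    inferInstanceAs (FirstCountableTopology (Fin n → Fin n → ℝ))
  constructor
  · intro h
    obtain ⟨c, d, hd, hs, hcd⟩ := mem_tangentConeAt_iff_exists_seq.1 h
    obtain ⟨N, hN⟩ := eventually_atTop.1 hs
    choose! g hg hgd using hN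
    have hd' : ∀ k, ((g (k + N) : Matrix.orthogonalGroup (Fin n) ℝ) :
        Matrix (Fin n) (Fin n) ℝ) - 1 = d (k + N) := fun k => by
      rw [hgd _ (Nat.le_add_left N k)]; abel
    refine ⟨fun k => c (k + N), fun k => g (k + N), fun k => hg _ (Nat.le_add_left N k), ?_, ?_⟩
    · simp only [hd']; exact (tendsto_add_atTop_iff_nat N).2 hd
    · simp only [hd']; exact (tendsto_add_atTop_iff_nat N).2 hcd
  · rintro ⟨c, g, hg, h0, hA⟩
    exact mem_tangentConeAt_of_seq atTop c _ h0
      (Eventually.of_forall fun k => ⟨g k, hg k, by abel⟩) hA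

theorem transpose_mul_self_of_orthogonal (g : Matrix.orthogonalGroup (Fin n) ℝ) :
    (g : Matrix (Fin n) (Fin n) ℝ)ᵀ * (g : Matrix (Fin n) (Fin n) ℝ) = 1 :=
  (Matrix.mem_orthogonalGroup_iff' (Fin n) ℝ).1 g.2

theorem mul_transpose_self_of_orthogonal (g : Matrix.orthogonalGroup (Fin n) ℝ) :
    (g : Matrix (Fin n) (Fin n) ℝ) * (g : Matrix (Fin n) (Fin n) ℝ)ᵀ = 1 :=
  (Matrix.mem_orthogonalGroup_iff (Fin n) ℝ).1 g.2

/-- Expands `g * gᵀ = 1` around `1`: the symmetric part of `g - 1` is of second order, so it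
vanishes in rescaled limits. -/
theorem sub_one_add_transpose (g : Matrix.orthogonalGroup (Fin n) ℝ) :
    ((g : Matrix (Fin n) (Fin n) ℝ) - 1) + ((g : Matrix (Fin n) (Fin n) ℝ) - 1)ᵀ =
      -(((g : Matrix (Fin n) (Fin n) ℝ) - 1) * ((g : Matrix (Fin n) (Fin n) ℝ) - 1)ᵀ) := by
  rw [Matrix.transpose_sub, Matrix.transpose_one, sub_mul, mul_sub, mul_sub,
    mul_transpose_self_of_orthogonal]
  simp only [mul_one, one_mul]
  abel

theorem transpose_eq_neg_of_mem_tangentMatrices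
    {G : Subgroup (Matrix.orthogonalGroup (Fin n) ℝ)} {A : Matrix (Fin n) (Fin n) ℝ}
    (hA : A ∈ tangentMatrices G) : Aᵀ = -A := by
  obtain ⟨c, g, -, h0, hc⟩ := mem_tangentMatrices_iff.1 hA
  have h1 := hc.add ((continuous_id.matrix_transpose.tendsto A).comp hc)
  have h2 := (hc.mul ((continuous_id.matrix_transpose.tendsto 0).comp h0)).neg
  have h3 : A + Aᵀ = -(A * 0ᵀ) := by
    refine tendsto_nhds_unique h1 (h2.congr fun k => ?_)
    simp only [Function.comp, id]
    rw [Matrix.transpose_smul, ← smul_add, sub_one_add_transpose, smul_neg, smul_mul_assoc]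
  rw [Matrix.transpose_zero, mul_zero, neg_zero] at h3
  exact (neg_eq_of_add_eq_zero_right h3).symm

theorem conj_mem_tangentMatrices
    {G : Subgroup (Matrix.orthogonalGroup (Fin n) ℝ)} {A : Matrix (Fin n) (Fin n) ℝ}
    (hA : A ∈ tangentMatrices G) {h : Matrix.orthogonalGroup (Fin n) ℝ} (hh : h ∈ G) :
    (h : Matrix (Fin n) (Fin n) ℝ) * A * (h : Matrix (Fin n) (Fin n) ℝ)ᵀ ∈ tangentMatrices G := by
  obtain ⟨c, g, hg, h0, hc⟩ := mem_tangentMatrices_iff.1 hA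
  have hinv : ((h⁻¹ : Matrix.orthogonalGroup (Fin n) ℝ) : Matrix (Fin n) (Fin n) ℝ) =
      (h : Matrix (Fin n) (Fin n) ℝ)ᵀ := rfl
  have key : ∀ k, ((h * g k * h⁻¹ : Matrix.orthogonalGroup (Fin n) ℝ) :
      Matrix (Fin n) (Fin n) ℝ) - 1 =
      h * ((g k : Matrix (Fin n) (Fin n) ℝ) - 1) * (h : Matrix (Fin n) (Fin n) ℝ)ᵀ := by
    intro k
    rw [mul_sub, sub_mul, mul_one, mul_transpose_self_of_orthogonal]
    rfl
  refine mem_tangentMatrices_iff.2 ⟨c, fun k => h * g k * h⁻¹,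
    fun k => G.mul_mem (G.mul_mem hh (hg k)) (G.inv_mem hh), ?_, ?_⟩
  · simp only [key]
    simpa using (h0.const_mul (h : Matrix (Fin n) (Fin n) ℝ)).mul_const
      (h : Matrix (Fin n) (Fin n) ℝ)ᵀ
  · simp only [key]
    refine ((hc.const_mul (h : Matrix (Fin n) (Fin n) ℝ)).mul_const
      (h : Matrix (Fin n) (Fin n) ℝ)ᵀ).congr fun k => ?_
    rw [mul_smul_comm, smul_mul_assoc]

section

attribute [local instance] Matrix.normedAddCommGroup Matrix.normedSpace

theorem exists_ne_zero_mem_tangentConeAt_matrix {s : Set (Matrix (Fin n) (Fin n) ℝ)}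
    {x : Matrix (Fin n) (Fin n) ℝ} (hx : AccPt x (𝓟 s)) :
    ∃ A ∈ tangentConeAt ℝ s x, A ≠ 0 := by
  have : ProperSpace (Matrix (Fin n) (Fin n) ℝ) := FiniteDimensional.proper_real _
  obtain ⟨A, h1, h2⟩ := tangentConeAt_nonempty_of_properSpace (𝕜 := ℝ) hx
  exact ⟨A, h1, h2⟩

end

/-- An infinite subset of a compact group accumulates at some `g`, which lies in `G` by closedness;
translating by `g⁻¹` moves the accumulation to `1`. -/
theorem exists_ne_zero_mem_tangentMatrices {G : Subgroup (Matrix.orthogonalGroup (Fin n) ℝ)}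
    (hclosed : IsClosed (G : Set (Matrix.orthogonalGroup (Fin n) ℝ)))
    (hinf : (G : Set (Matrix.orthogonalGroup (Fin n) ℝ)).Infinite) :
    ∃ A ∈ tangentMatrices G, A ≠ 0 := by
  have := compactSpace_orthogonalGroup (n := n)
  obtain ⟨g, hg⟩ := hinf.exists_accPt_principal
  have hgG : g ∈ G := isClosed_iff_accPt.1 hclosed g hg
  apply exists_ne_zero_mem_tangentConeAt_matrix
  rw [accPt_iff_frequently] at hg ⊢
  have hcont : Tendsto (fun h : Matrix.orthogonalGroup (Fin n) ℝ =>
      ((g⁻¹ * h : Matrix.orthogonalGroup (Fin n) ℝ) : Matrix (Fin n) (Fin n) ℝ)) (𝓝 g) (𝓝 1) := by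
    have : Continuous (fun h : Matrix.orthogonalGroup (Fin n) ℝ =>
      ((g⁻¹ * h : Matrix.orthogonalGroup (Fin n) ℝ) : Matrix (Fin n) (Fin n) ℝ)) :=
      continuous_subtype_val.comp (continuous_const.mul continuous_id)
    have h := this.tendsto g
    rwa [inv_mul_cancel] at h
  refine hcont.frequently (hg.mono fun h hh => ⟨fun h1 => hh.1 ?_, g⁻¹ * h,
    G.mul_mem (G.inv_mem hgG) hh.2, rfl⟩)
  have : g⁻¹ * h = 1 := Subtype.ext h1
  exact (inv_mul_eq_one.1 this).symm

/-- If `x` maximizes the height over `y` on its orbit, then the tangent directions of the orbit at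
`x` are horizontal. -/
theorem mulVec_dotProduct_eq_zero_of_max {G : Subgroup (Matrix.orthogonalGroup (Fin n) ℝ)}
    {x y : Fin n → ℝ}
    (hmax : ∀ g ∈ G, (g : Matrix (Fin n) (Fin n) ℝ) *ᵥ x ⬝ᵥ y ≤ x ⬝ᵥ y)
    {A : Matrix (Fin n) (Fin n) ℝ} (hA : A ∈ tangentMatrices G) : A *ᵥ x ⬝ᵥ y = 0 := by
  obtain ⟨c, g, hg, h0, hc⟩ := mem_tangentMatrices_iff.1 hA
  have hf : Continuous fun M : Matrix (Fin n) (Fin n) ℝ => M *ᵥ x ⬝ᵥ y :=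
    (continuous_id.matrix_mulVec continuous_const).dotProduct continuous_const
  have h1 := (hf.tendsto A).comp hc
  have h2 := (hf.tendsto _).comp (hc.mul ((continuous_id.matrix_transpose.tendsto 0).comp h0))
  rw [id, Matrix.transpose_zero, mul_zero, Matrix.zero_mulVec, zero_dotProduct] at h2
  refine tendsto_nhds_unique h1 (squeeze_zero_norm (fun k => ?_)
    (tendsto_norm_zero.comp h2))
  -- The scalars `c k` may have either sign, so an absolute bound is needed. The terms for `g k` and
  -- its inverse, the transpose, are both nonpositive and have a sum of second order; hence each is
  -- of second order.
  have hle : ((g k : Matrix (Fin n) (Fin n) ℝ) - 1) *ᵥ x ⬝ᵥ y ≤ 0 := by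
    rw [Matrix.sub_mulVec, Matrix.one_mulVec, sub_dotProduct]
    linarith [hmax (g k) (hg k)]
  have hle' : ((g k : Matrix (Fin n) (Fin n) ℝ) - 1)ᵀ *ᵥ x ⬝ᵥ y ≤ 0 := by
    rw [Matrix.transpose_sub, Matrix.transpose_one, Matrix.sub_mulVec, Matrix.one_mulVec,
      sub_dotProduct]
    have : ((g k)⁻¹ : Matrix.orthogonalGroup (Fin n) ℝ) *ᵥ x ⬝ᵥ y ≤ x ⬝ᵥ y :=
      hmax (g k)⁻¹ (G.inv_mem (hg k))
    have hinv : (((g k)⁻¹ : Matrix.orthogonalGroup (Fin n) ℝ) : Matrix (Fin n) (Fin n) ℝ) =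
      (g k : Matrix (Fin n) (Fin n) ℝ)ᵀ := rfl
    rw [hinv] at this
    linarith
  have hsum := congrArg (fun M : Matrix (Fin n) (Fin n) ℝ => M *ᵥ x ⬝ᵥ y)
    (sub_one_add_transpose (g k))
  simp only [Matrix.add_mulVec, add_dotProduct, Matrix.neg_mulVec, neg_dotProduct] at hsum
  simp only [Function.comp, id, Matrix.smul_mulVec, smul_dotProduct, smul_mul_assoc,
    smul_eq_mul, norm_mul]
  refine mul_le_mul_of_nonneg_left ?_ (norm_nonneg _)
  rw [Real.norm_of_nonpos hle]
  refine le_trans ?_ (le_abs_self _)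
  linarith

/-- At a highest point `x` of an orbit over `y`, tangent directions are orthogonal to `y`, so `H`
gives `x = y` or `x = -y`. -/
theorem isTransitiveOnSphere_of_tangentMatrices (hn : 2 ≤ n)
    {G : Subgroup (Matrix.orthogonalGroup (Fin n) ℝ)}
    (hclosed : IsClosed (G : Set (Matrix.orthogonalGroup (Fin n) ℝ)))
    (H : ∀ x y : EuclideanSpace ℝ (Fin n), ‖x‖ = 1 → ‖y‖ = 1 →
      (∀ A ∈ tangentMatrices G, A *ᵥ x.ofLp ⬝ᵥ y.ofLp = 0) → inner ℝ x y ^ 2 = 1) :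
    IsTransitiveOnSphere G := by
  have hdot : ∀ x y : EuclideanSpace ℝ (Fin n), inner ℝ x y = x.ofLp ⬝ᵥ y.ofLp := fun x y => by
    rw [EuclideanSpace.inner_eq_star_dotProduct, star_trivial, dotProduct_comm]
  intro x₀ hx₀ y hy
  rw [mem_sphere_zero_iff_norm] at hx₀ hy
  have := compactSpace_orthogonalGroup (n := n)
  have hcont : Continuous fun g : Matrix.orthogonalGroup (Fin n) ℝ => inner ℝ (orthAct g x₀) y := by
    simp only [hdot, orthAct]
    exact (continuous_subtype_val.matrix_mulVec continuous_const).dotProduct continuous_const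
  obtain ⟨g₀, hg₀, hmax⟩ := hclosed.isCompact.exists_isMaxOn ⟨1, G.one_mem⟩ hcont.continuousOn
  set x := orthAct g₀ x₀ with hx
  have hx1 : ‖x‖ = 1 := by rw [hx, norm_orthAct, hx₀]
  have hmax' : ∀ g ∈ G, inner ℝ (orthAct g x) y ≤ inner ℝ x y := fun g hg => by
    have := hmax (G.mul_mem hg hg₀)
    simpa only [mem_ofPred_eq, orthAct_mul] using this
  have hsq := H x y hx1 hy fun A hA => by
    refine mulVec_dotProduct_eq_zero_of_max (fun g hg => ?_) hA
    have := hmax' g hg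
    rwa [hdot, hdot] at this
  rcases mul_self_eq_one_iff.1 ((sq _).symm.trans hsq) with h | h
  · exact ⟨g₀, hg₀, (inner_eq_one_iff_of_norm_eq_one hx1 hy).1 h⟩
  · exfalso
    have hyx : y = -x := by
      have : inner ℝ x (-y) = 1 := by rw [inner_neg_right, h, neg_neg]
      rw [(inner_eq_one_iff_of_norm_eq_one hx1 (by rwa [norm_neg])).1 this, neg_neg]
    -- The maximal height is `-1`, the least possible, so the whole orbit is the point `x`. Then `H`
    -- applies to `x` and every unit vector, which is absurd for two coordinate vectors.
    have hfix : ∀ g ∈ G, orthAct g x = x := fun g hg => by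
      refine (inner_eq_one_iff_of_norm_eq_one (𝕜 := ℝ) (by rwa [norm_orthAct]) hx1).1 ?_
      have h1 := hmax' g hg
      rw [h, hyx, inner_neg_right] at h1
      have h2 := real_inner_le_norm (orthAct g x) x
      rw [norm_orthAct, hx1] at h2
      linarith
    have hall : ∀ z : EuclideanSpace ℝ (Fin n), ‖z‖ = 1 → inner ℝ x z ^ 2 = 1 := fun z hz => by
      refine H x z hx1 hz fun A hA => mulVec_dotProduct_eq_zero_of_max (fun g hg => ?_) hA
      have := congrArg WithLp.ofLp (hfix g hg)
      exact le_of_eq (congrArg (· ⬝ᵥ z.ofLp) this)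
    have h0 := hall (EuclideanSpace.single ⟨0, by omega⟩ 1) (by simp)
    have h1 := hall (EuclideanSpace.single ⟨1, by omega⟩ 1) (by simp)
    have hs := EuclideanSpace.real_norm_sq_eq x
    rw [hx1] at hs
    have hle := Finset.add_le_sum (s := Finset.univ) (f := fun i => x.ofLp i ^ 2)
      (fun i _ => sq_nonneg _) (Finset.mem_univ (⟨0, by omega⟩ : Fin n))
      (Finset.mem_univ (⟨1, by omega⟩ : Fin n)) (by simp)
    rw [EuclideanSpace.inner_single_right, one_mul, conj_trivial] at h0 h1
    linarith

end TangentCone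

/-! ### Finite orbits in dimensions two and three. -/

section Orbits

open Matrix

theorem finite_orbit_of_finite {n : ℕ} {G : Subgroup (Matrix.orthogonalGroup (Fin n) ℝ)}
    (hG : (G : Set (Matrix.orthogonalGroup (Fin n) ℝ)).Finite) (v : EuclideanSpace ℝ (Fin n)) :
    {x | ∃ g ∈ G, orthAct g v = x}.Finite :=
  hG.image fun g => orthAct g v

theorem exists_finite_orbit_of_invariant_line {n : ℕ}
    {G : Subgroup (Matrix.orthogonalGroup (Fin n) ℝ)}
    {L : Submodule ℝ (EuclideanSpace ℝ (Fin n))} (hL : Module.finrank ℝ L = 1)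
    (hinv : ∀ g ∈ G, ∀ x ∈ L, orthAct g x ∈ L) :
    ∃ v : EuclideanSpace ℝ (Fin n), v ≠ 0 ∧ {x | ∃ g ∈ G, orthAct g v = x}.Finite := by
  obtain ⟨⟨v, hvL⟩, hv, hspan⟩ := finrank_eq_one_iff'.1 hL
  have hv0 : v ≠ 0 := fun h => hv (Subtype.ext h)
  refine ⟨v, hv0, (Set.toFinite {v, -v}).subset ?_⟩
  rintro x ⟨g, hg, rfl⟩
  obtain ⟨c, hc⟩ := hspan ⟨orthAct g v, hinv g hg v hvL⟩
  have hc' : c • v = orthAct g v := congrArg Subtype.val hc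
  have hn := norm_orthAct g v
  rw [← hc', norm_smul, mul_eq_right₀ (norm_ne_zero_iff.2 hv0)] at hn
  rw [← hc']
  rcases eq_or_eq_neg_of_abs_eq hn with rfl | rfl
  · simp
  · simp

theorem orthAct_mem_orthogonal {n : ℕ} {G : Subgroup (Matrix.orthogonalGroup (Fin n) ℝ)}
    {L : Submodule ℝ (EuclideanSpace ℝ (Fin n))}
    (hinv : ∀ g ∈ G, ∀ x ∈ L, orthAct g x ∈ L) {g : Matrix.orthogonalGroup (Fin n) ℝ}
    (hg : g ∈ G) {x : EuclideanSpace ℝ (Fin n)} (hx : x ∈ Lᗮ) : orthAct g x ∈ Lᗮ := by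
  rw [Submodule.mem_orthogonal] at hx ⊢
  intro u hu
  rw [← orthAct_orthAct_inv g u, inner_orthAct]
  exact hx _ (hinv _ (G.inv_mem hg) u hu)

theorem exists_finite_orbit_two {G : Subgroup (Matrix.orthogonalGroup (Fin 2) ℝ)}
    (hclosed : IsClosed (G : Set (Matrix.orthogonalGroup (Fin 2) ℝ)))
    (hG : ¬ IsTransitiveOnSphere G) :
    ∃ v : EuclideanSpace ℝ (Fin 2), v ≠ 0 ∧ {x | ∃ g ∈ G, orthAct g v = x}.Finite := by
  by_cases hfin : (G : Set (Matrix.orthogonalGroup (Fin 2) ℝ)).Finite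
  · exact ⟨EuclideanSpace.single 0 1, by simp, finite_orbit_of_finite hfin _⟩
  refine absurd (isTransitiveOnSphere_of_tangentMatrices le_rfl hclosed fun x y hx hy h => ?_) hG
  obtain ⟨A, hA, hA0⟩ := exists_ne_zero_mem_tangentMatrices hclosed hfin
  have hskew := fun i j => congrFun (congrFun (transpose_eq_neg_of_mem_tangentMatrices hA) i) j
  simp only [Matrix.transpose_apply, Matrix.neg_apply] at hskew
  have h00 : A 0 0 = 0 := by linarith [hskew 0 0]
  have h11 : A 1 1 = 0 := by linarith [hskew 1 1]
  have h10 : A 0 1 = -A 1 0 := hskew 1 0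
  have ha : A 1 0 ≠ 0 := by
    intro h
    apply hA0
    ext i j
    fin_cases i <;> fin_cases j <;> simp [h00, h11, h10, h]
  have hxy := h A hA
  have hx' := EuclideanSpace.real_norm_sq_eq x
  have hy' := EuclideanSpace.real_norm_sq_eq y
  simp only [Matrix.mulVec, dotProduct, Fin.sum_univ_two, h00, h11, h10] at hxy
  rw [hx, Fin.sum_univ_two] at hx'
  rw [hy, Fin.sum_univ_two] at hy'
  have h2 : x 0 * y 1 - x 1 * y 0 = 0 := by
    refine (mul_eq_zero.1 (?_ : A 1 0 * (x 0 * y 1 - x 1 * y 0) = 0)).resolve_left ha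
    linarith
  simp only [PiLp.inner_apply, Fin.sum_univ_two, RCLike.inner_apply, conj_trivial]
  -- Lagrange's identity: the squares of the inner product and of the determinant add up to `‖x‖²
  -- ‖y‖²`.
  linear_combination (-(x 0 * y 1 - x 1 * y 0)) * h2 - hx' * (y 0 ^ 2 + y 1 ^ 2) - hy'

/-- The axis of a skew-symmetric matrix of order three. -/
def matrixAxis (A : Matrix (Fin 3) (Fin 3) ℝ) : EuclideanSpace ℝ (Fin 3) :=
  !₂[A 2 1, A 0 2, A 1 0]

theorem eq_of_transpose_eq_neg {A : Matrix (Fin 3) (Fin 3) ℝ} (hA : Aᵀ = -A) :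
    A = !![0, -A 1 0, A 0 2; A 1 0, 0, -A 2 1; -A 0 2, A 2 1, 0] := by
  have hskew := fun i j => congrFun (congrFun hA i) j
  simp only [Matrix.transpose_apply, Matrix.neg_apply] at hskew
  ext i j
  fin_cases i <;> fin_cases j <;> simp <;> linarith [hskew 0 0, hskew 1 1, hskew 2 2, hskew 0 1,
    hskew 0 2, hskew 1 2]

/-- A skew `A` acts as the cross product with its axis, and cross products transform by the cofactor
matrix, which is `det h • h` for orthogonal `h`. -/
theorem matrixAxis_conj (h : Matrix.orthogonalGroup (Fin 3) ℝ) {A : Matrix (Fin 3) (Fin 3) ℝ}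
    (hA : Aᵀ = -A) :
    matrixAxis ((h : Matrix (Fin 3) (Fin 3) ℝ) * A * (h : Matrix (Fin 3) (Fin 3) ℝ)ᵀ) =
      (h : Matrix (Fin 3) (Fin 3) ℝ).det • orthAct h (matrixAxis A) := by
  have hadj : (h : Matrix (Fin 3) (Fin 3) ℝ).adjugate =
      (h : Matrix (Fin 3) (Fin 3) ℝ).det • (h : Matrix (Fin 3) (Fin 3) ℝ)ᵀ := by
    have := Matrix.adjugate_mul (h : Matrix (Fin 3) (Fin 3) ℝ)
    calc _ = (h : Matrix (Fin 3) (Fin 3) ℝ).adjugate *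
        ((h : Matrix (Fin 3) (Fin 3) ℝ) * (h : Matrix (Fin 3) (Fin 3) ℝ)ᵀ) := by
          rw [mul_transpose_self_of_orthogonal, mul_one]
      _ = _ := by rw [← mul_assoc, this, smul_mul_assoc, one_mul]
  have hadj' : (h : Matrix (Fin 3) (Fin 3) ℝ).adjugateᵀ =
      (h : Matrix (Fin 3) (Fin 3) ℝ).det • (h : Matrix (Fin 3) (Fin 3) ℝ) := by
    rw [hadj, Matrix.transpose_smul, Matrix.transpose_transpose]
  have hR : (h : Matrix (Fin 3) (Fin 3) ℝ).det • orthAct h (matrixAxis A) =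
      WithLp.toLp 2 ((h : Matrix (Fin 3) (Fin 3) ℝ).adjugateᵀ *ᵥ (matrixAxis A).ofLp) := by
    rw [hadj', Matrix.smul_mulVec]; rfl
  rw [hR]
  -- With the adjugate in place, the identity is polynomial and holds for every matrix `M`.
  generalize (h : Matrix (Fin 3) (Fin 3) ℝ) = M
  rw [Matrix.adjugate_fin_three]
  have hA' := eq_of_transpose_eq_neg hA
  generalize A 1 0 = c at hA'
  generalize A 0 2 = b at hA'
  generalize A 2 1 = a at hA'
  subst hA'
  ext i
  fin_cases i <;>
    simp [matrixAxis, Matrix.mul_apply, Matrix.mulVec, dotProduct, Fin.sum_univ_three] <;> ring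

/-- Cyclic symmetry of the triple product. -/
theorem mulVec_dotProduct_eq_inner_axis {A : Matrix (Fin 3) (Fin 3) ℝ} (hA : Aᵀ = -A)
    (x y : Fin 3 → ℝ) :
    A *ᵥ x ⬝ᵥ y = inner ℝ (matrixAxis A) (WithLp.toLp 2 (crossProduct x y)) := by
  have hA' := eq_of_transpose_eq_neg hA
  generalize A 1 0 = c at hA'
  generalize A 0 2 = b at hA'
  generalize A 2 1 = a at hA'
  subst hA'
  simp [matrixAxis, Matrix.mulVec, dotProduct, Fin.sum_univ_three, cross_apply,
    PiLp.inner_apply]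
  ring

theorem exists_finite_orbit_three {G : Subgroup (Matrix.orthogonalGroup (Fin 3) ℝ)}
    (hclosed : IsClosed (G : Set (Matrix.orthogonalGroup (Fin 3) ℝ)))
    (hG : ¬ IsTransitiveOnSphere G) :
    ∃ v : EuclideanSpace ℝ (Fin 3), v ≠ 0 ∧ {x | ∃ g ∈ G, orthAct g v = x}.Finite := by
  by_cases hfin : (G : Set (Matrix.orthogonalGroup (Fin 3) ℝ)).Finite
  · exact ⟨EuclideanSpace.single 0 1, by simp, finite_orbit_of_finite hfin _⟩
  set V : Submodule ℝ (EuclideanSpace ℝ (Fin 3)) :=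
    Submodule.span ℝ (matrixAxis '' tangentMatrices G) with hV
  have hinv : ∀ g ∈ G, ∀ x ∈ V, orthAct g x ∈ V := by
    intro g hg x hx
    induction hx using Submodule.span_induction with
    | mem x hx =>
      obtain ⟨A, hA, rfl⟩ := hx
      have h1 := matrixAxis_conj g (transpose_eq_neg_of_mem_tangentMatrices hA)
      have hdet : (g : Matrix (Fin 3) (Fin 3) ℝ).det ≠ 0 := by
        intro h
        have := congrArg Matrix.det (transpose_mul_self_of_orthogonal g)
        rw [Matrix.det_mul, h, mul_zero, Matrix.det_one] at this
        exact zero_ne_one this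
      rw [← V.smul_mem_iff hdet, ← h1]
      exact Submodule.subset_span ⟨_, conj_mem_tangentMatrices hA hg, rfl⟩
    | zero => simp [orthAct]
    | add x y _ _ hx hy => rw [orthAct_add]; exact V.add_mem hx hy
    | smul a x _ hx => rw [orthAct_smul]; exact V.smul_mem a hx
  have hne : V ≠ ⊥ := by
    obtain ⟨A, hA, hA0⟩ := exists_ne_zero_mem_tangentMatrices hclosed hfin
    intro h
    have h0 : matrixAxis A = 0 := by
      rw [← Submodule.mem_bot ℝ, ← h]
      exact Submodule.subset_span ⟨A, hA, rfl⟩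
    apply hA0
    have e := fun i => congrFun (congrArg WithLp.ofLp h0) i
    have e0 : A 2 1 = 0 := e 0
    have e1 : A 0 2 = 0 := e 1
    have e2 : A 1 0 = 0 := e 2
    rw [eq_of_transpose_eq_neg (transpose_eq_neg_of_mem_tangentMatrices hA), e0, e1, e2]
    ext i j
    fin_cases i <;> fin_cases j <;> simp
  have htop : V ≠ ⊤ := by
    intro h
    refine hG (isTransitiveOnSphere_of_tangentMatrices (by norm_num) hclosed
      fun x y hx hy hxy => ?_)
    -- By the triple product, `x × y` is orthogonal to every axis; if these span the space then `x ×
    -- y = 0`, and Lagrange's identity gives the claim.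
    have hperp : WithLp.toLp 2 (crossProduct x.ofLp y.ofLp) ∈ Vᗮ := by
      rw [hV, Submodule.mem_orthogonal]
      intro u hu
      induction hu using Submodule.span_induction with
      | mem x hx =>
        obtain ⟨A, hA, rfl⟩ := hx
        rw [← mulVec_dotProduct_eq_inner_axis (transpose_eq_neg_of_mem_tangentMatrices hA)]
        exact hxy A hA
      | zero => exact inner_zero_left _
      | add x y _ _ hx hy => rw [inner_add_left, hx, hy, add_zero]
      | smul a x _ hx => rw [inner_smul_left, hx, mul_zero]
    rw [h, Submodule.top_orthogonal_eq_bot, Submodule.mem_bot] at hperp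
    have e := fun i => congrFun (congrArg WithLp.ofLp hperp) i
    have e0 : x 1 * y 2 - x 2 * y 1 = 0 := e 0
    have e1 : x 2 * y 0 - x 0 * y 2 = 0 := e 1
    have e2 : x 0 * y 1 - x 1 * y 0 = 0 := e 2
    have hx' := EuclideanSpace.real_norm_sq_eq x
    have hy' := EuclideanSpace.real_norm_sq_eq y
    rw [hx, Fin.sum_univ_three] at hx'
    rw [hy, Fin.sum_univ_three] at hy'
    simp only [PiLp.inner_apply, Fin.sum_univ_three, RCLike.inner_apply, conj_trivial]
    linear_combination (-(x 1 * y 2 - x 2 * y 1)) * e0 - (x 2 * y 0 - x 0 * y 2) * e1 -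
      (x 0 * y 1 - x 1 * y 0) * e2 - hx' * (y 0 ^ 2 + y 1 ^ 2 + y 2 ^ 2) - hy'
  have h3 : Module.finrank ℝ V + Module.finrank ℝ Vᗮ = 3 := by
    rw [Submodule.finrank_add_finrank_orthogonal]; simp
  have hpos : Module.finrank ℝ V ≠ 0 := fun h => hne (Submodule.finrank_eq_zero.1 h)
  have hpos' : Module.finrank ℝ Vᗮ ≠ 0 := fun h =>
    htop ((Submodule.orthogonal_eq_bot_iff).1 (Submodule.finrank_eq_zero.1 h))
  -- Two positive dimensions with sum `3`: one of them is `1`.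
  have hcases : Module.finrank ℝ V = 1 ∨ Module.finrank ℝ Vᗮ = 1 := by omega
  rcases hcases with h | h
  · exact exists_finite_orbit_of_invariant_line h hinv
  · exact exists_finite_orbit_of_invariant_line h fun g hg x hx => orthAct_mem_orthogonal hinv hg hx

end Orbits

theorem corollary10 (n : ℕ) (hn : n = 2 ∨ n = 3)
    (G : Subgroup (Matrix.orthogonalGroup (Fin n) ℝ))
    (hclosed : IsClosed (G : Set (Matrix.orthogonalGroup (Fin n) ℝ)))
    (hnontrans : ¬ IsTransitiveOnSphere G) :
    ∃ (W : Finset (EuclideanSpace ℝ (Fin n))) (K : Set (EuclideanSpace ℝ (Fin n))),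
      -- a polyellipse / polyellipsoid with a `G`-invariant system of focuses
      IsPolyellipsoid W K ∧ IsInvariantUnder G (W : Set (EuclideanSpace ℝ (Fin n))) ∧
      -- a compact convex body containing the origin in its interior
      IsCompact K ∧ Convex ℝ K ∧ (0 : EuclideanSpace ℝ (Fin n)) ∈ interior K ∧
      -- not a unit ball with respect to any inner product
      ¬ IsInnerProductUnitBall K ∧
      -- invariant under the elements of `G`
      IsInvariantUnder G K ∧
      -- with smooth boundary
      IsSmoothHypersurface (frontier K) := by
  rcases hn with rfl | rfl
  · obtain ⟨v, hv, hfin⟩ := exists_finite_orbit_two hclosed hnontrans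
    exact exists_polyellipsoid_of_finite_orbit le_rfl G hv hfin
  · obtain ⟨v, hv, hfin⟩ := exists_finite_orbit_three hclosed hnontrans
    exact exists_polyellipsoid_of_finite_orbit (by norm_num) G hv hfin
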